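/- **Definitions.** A partial metric on a set $X$ is a function $p:X\times X\to[0,+\infty]$ with (P1) $p(x,x)\le p(x,y)$; (P2) if $p(x,x)=p(x,y)=p(y,y)$ then $x=y$; (P3) $p(x,y)=p(y,x)$; (P4) $p(x,y)\le p(x,z)+p(z,y)-p(z,z)$. Its open balls are $B^p_\epsilon(x)=\{y\mid p(y,x)<p(x,x)+\epsilon\}$ with $0<\epsilon<+\infty$, and its topology consists of all unions of open balls; $p$ *quantifies* a dcpo $X$ when this topology is exactly the Scott topology of $X$. In a dcpo, $x\ll y$ means that every (nonempty) directed set $\Delta$ with $y\le\bigvee\Delta$ has an element $d\ge x$; a basis is a subset $B$ such that, for every $x$, the set $\{b\in B\mid b\ll x\}$ is (nonempty and) directed with supremum $x$. A bounded complete domain is a nonempty dcpo with a countable basis in which every finite subset that has an upper bound has a supremum (so it has a least element $\bot$). Let $D$ be a bounded complete domain. Put $D_0=D$ and let $D_{n+1}$ be the set of Scott continuous functions $D_n\to D_n$, ordered pointwise. Define $i_n:D_n\to D_{n+1}$ and $j_n:D_{n+1}\to D_n$ by $i_0(x)=(y\mapsto x)$, $j_0(f)=f(\bot)$, $i_{n+1}(f)=i_n\circ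 f\circ j_n$, $j_{n+1}(g)=j_n\circ g\circ i_n$. Let $D_\infty=\{x\in\prod_{n\ge0}D_n\mid x_n=j_n(x_{n+1})\text{ for all }n\}$, ordered componentwise. For each $n\ge 0$ let $(a^n_i)_{i\ge1}$ be an enumeration of a basis of $D_n$ (repetitions allowed). **Theorem.** Let $p$ be a partial metric on $D$ with values in $[0,1]$ that quantifies $D$. Define $p_0=p$, $$p_{n+1}(f,g)=\sum_{i=1}^{\infty}\frac1{2^i}\,p_n\big(f(a^n_i),g(a^n_i)\big)\quad(f,g\in D_{n+1}),\qquad p_\infty(x,y)=\sum_{n=1}^{\infty}\frac1{2^n}\,p_n(x_n,y_n)\quad(x,y\in D_\infty).$$ Then $p_\infty$ is a partial metric on $D_\infty$, and it quantifies $D_\infty$: its topology is exactly the Scott topology of $D_\infty$. -/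

import Mathlib

open scoped ENNReal Topology

namespace ScottModel

universe u v

section Domains

variable {X : Type u} [PartialOrder X]

/-- The way-below relation `x ≪ y`. -/
def WayBelow (x y : X) : Prop :=
  ∀ d : Set X, d.Nonempty → DirectedOn (· ≤ ·) d → ∀ s : X, IsLUB d s → y ≤ s → ∃ z ∈ d, x ≤ z

/-- `B` is a basis: every `x` is the directed supremum of the elements of `B` way below it. -/
def IsDomainBasis (B : Set X) : Prop :=
  ∀ x : X, {y | y ∈ B ∧ WayBelow y x}.Nonempty ∧
    DirectedOn (· ≤ ·) {y | y ∈ B ∧ WayBelow y x} ∧ IsLUB {y | y ∈ B ∧ WayBelow y x} x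

/-- The order-theoretic properties that turn a (pointed) dcpo into a bounded complete domain:
there is a countable basis, and every finite set with an upper bound has a least upper bound. -/
structure IsBoundedCompleteDomain (X : Type u) [PartialOrder X] : Prop where
  exists_countable_basis : ∃ B : Set X, B.Countable ∧ IsDomainBasis B
  exists_isLUB : ∀ Y : Set X, Y.Finite → BddAbove Y → ∃ s, IsLUB Y s

end Domains

section PartialMetrics

variable {X : Type u}

/-- Partial metrics with values in `[0, ∞]`; the last axiom is
`p(x,y) ≤ p(x,z) + p(z,y) - p(z,z)`, written without subtraction. -/
structure IsPartialMetric (p : X → X → ℝ≥0∞) : Prop where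
  self_le : ∀ x y, p x x ≤ p x y
  eq_of_eq : ∀ x y, p x x = p x y → p x y = p y y → x = y
  symm : ∀ x y, p x y = p y x
  triangle : ∀ x y z, p x y + p z z ≤ p x z + p z y

/-- The open ball with centre `x` and radius `ε`. -/
def pball (p : X → X → ℝ≥0∞) (x : X) (ε : ℝ≥0∞) : Set X := {y | p y x < p x x + ε}

/-- The topology of `p`: the collection of all unions of open balls with radii in `(0, ∞)`. -/
def pOpens (p : X → X → ℝ≥0∞) : Set (Set X) :=
  {U | ∃ S : Set (X × ℝ≥0∞), (∀ c ∈ S, 0 < c.2 ∧ c.2 < ⊤) ∧ U = ⋃ c ∈ S, pball p c.1 c.2}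

/-- `p` quantifies the partial order `X`: its open sets are exactly the Scott open sets. -/
def Quantifies [PartialOrder X] (p : X → X → ℝ≥0∞) : Prop :=
  pOpens p = {U | IsOpen[Topology.scott X Set.univ] U}

end PartialMetrics

section FunctionSpace

/-- The space `X ⇒ Y` of Scott continuous functions. -/
@[ext]
structure ScottMap (X : Type u) (Y : Type v) [PartialOrder X] [PartialOrder Y] where
  toFun : X → Y
  cont : ScottContinuous toFun

instance (X : Type u) (Y : Type v) [PartialOrder X] [PartialOrder Y] :
    CoeFun (ScottMap X Y) (fun _ => X → Y) := ⟨ScottMap.toFun⟩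

/-- The pointwise order. -/
instance (X : Type u) (Y : Type v) [PartialOrder X] [PartialOrder Y] :
    PartialOrder (ScottMap X Y) where
  le f g := ∀ x, f x ≤ g x
  le_refl f x := le_refl (f x)
  le_trans _ _ _ hfg hgh x := (hfg x).trans (hgh x)
  le_antisymm _ _ hfg hgf := ScottMap.ext (funext fun x => (hfg x).antisymm (hgf x))

theorem directedOn_eval {X : Type u} {Y : Type v} [PartialOrder X] [PartialOrder Y]
    {F : Set (ScottMap X Y)} (hF : DirectedOn (· ≤ ·) F) (x : X) :
    DirectedOn (· ≤ ·) ((fun f : ScottMap X Y => f x) '' F) := by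
  rintro _ ⟨f, hf, rfl⟩ _ ⟨g, hg, rfl⟩
  obtain ⟨h, hh, h1, h2⟩ := hF f hf g hg
  exact ⟨h x, ⟨h, hh, rfl⟩, h1 x, h2 x⟩

theorem scottContinuous_sSup {X : Type u} {Y : Type v} [PartialOrder X] [CompletePartialOrder Y]
    {F : Set (ScottMap X Y)} (hF : DirectedOn (· ≤ ·) F) :
    ScottContinuous (fun x => sSup ((fun f : ScottMap X Y => f x) '' F)) := by
  intro d hd hdd a ha
  constructor
  · rintro _ ⟨x, hx, rfl⟩
    refine (directedOn_eval hF x).sSup_le ?_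
    rintro _ ⟨f, hf, rfl⟩
    exact le_trans (f.cont.monotone (ha.1 hx)) ((directedOn_eval hF a).le_sSup ⟨f, hf, rfl⟩)
  · intro b hb
    refine (directedOn_eval hF a).sSup_le ?_
    rintro _ ⟨f, hf, rfl⟩
    refine (f.cont hd hdd ha).2 ?_
    rintro _ ⟨x, hx, rfl⟩
    exact le_trans ((directedOn_eval hF x).le_sSup ⟨f, hf, rfl⟩) (hb ⟨x, hx, rfl⟩)

open Classical in
/-- Directed suprema in the function space are computed pointwise. -/
noncomputable instance (X : Type u) (Y : Type v) [PartialOrder X] [CompletePartialOrder Y] :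
    SupSet (ScottMap X Y) where
  sSup F := if hF : DirectedOn (· ≤ ·) F then ⟨_, scottContinuous_sSup hF⟩
    else ⟨fun _ => ⊥, ScottContinuous.const ⊥⟩

noncomputable instance (X : Type u) (Y : Type v) [PartialOrder X] [CompletePartialOrder Y] :
    CompletePartialOrder (ScottMap X Y) :=
  CompletePartialOrder.ofLubOfDirected (ScottMap X Y) <| by
    intro F hF
    have h : sSup F = (⟨_, scottContinuous_sSup hF⟩ : ScottMap X Y) := dif_pos hF
    rw [h]
    constructor
    · intro f hf x
      exact (directedOn_eval hF x).le_sSup ⟨f, hf, rfl⟩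
    · intro g hg x
      refine (directedOn_eval hF x).sSup_le ?_
      rintro _ ⟨f, hf, rfl⟩
      exact hg hf x

theorem isLUB_eval {X : Type u} {Y : Type v} [PartialOrder X] [CompletePartialOrder Y]
    {F : Set (ScottMap X Y)} (hF : DirectedOn (· ≤ ·) F) {g : ScottMap X Y} (hg : IsLUB F g)
    (x : X) : IsLUB ((fun f : ScottMap X Y => f x) '' F) (g x) := by
  have h : g = (⟨_, scottContinuous_sSup hF⟩ : ScottMap X Y) :=
    (hg.unique hF.isLUB_sSup).trans (dif_pos hF)
  rw [h]
  exact (directedOn_eval hF x).isLUB_sSup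

variable {X Y Z : Type u}

/-- Composition `g ∘ f`. -/
def ScottMap.comp [PartialOrder X] [PartialOrder Y] [PartialOrder Z]
    (g : ScottMap Y Z) (f : ScottMap X Y) : ScottMap X Z :=
  ⟨fun x => g (f x), f.cont.comp g.cont⟩

/-- The map `x ↦ (y ↦ x)` from `X` to `X ⇒ X`. -/
def constMap (X : Type u) [PartialOrder X] : ScottMap X (ScottMap X X) :=
  ⟨fun x => ⟨fun _ => x, ScottContinuous.const x⟩, by
    intro d hd hdd a ha
    constructor
    · rintro _ ⟨x, hx, rfl⟩ y
      exact ha.1 hx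
    · intro g hg y
      refine ha.2 fun x hx => ?_
      exact hg ⟨x, hx, rfl⟩ y⟩

/-- The map `f ↦ f ⊥` from `X ⇒ X` to `X`. -/
def evalBot (X : Type u) [CompletePartialOrder X] : ScottMap (ScottMap X X) X :=
  ⟨fun f => f ⊥, fun _ _ hF _ hg => isLUB_eval hF hg ⊥⟩

/-- Given `i : X → Y` and `j : Y → X`, the map `f ↦ i ∘ f ∘ j` from `X ⇒ X` to `Y ⇒ Y`. -/
def conjMap [CompletePartialOrder X] [CompletePartialOrder Y]
    (i : ScottMap X Y) (j : ScottMap Y X) : ScottMap (ScottMap X X) (ScottMap Y Y) :=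
  ⟨fun f => i.comp (f.comp j), by
    intro F hF hFd g hg
    constructor
    · rintro _ ⟨f, hf, rfl⟩ y
      exact i.cont.monotone (hg.1 hf (j y))
    · intro h hh y
      refine (i.cont (hF.image _) (directedOn_eval hFd (j y)) (isLUB_eval hFd hg (j y))).2 ?_
      rintro _ ⟨_, ⟨f, hf, rfl⟩, rfl⟩
      exact hh ⟨f, hf, rfl⟩ y⟩

end FunctionSpace

section InverseLimit

/-- The sequence `D₀ = D`, `Dₙ₊₁ = (Dₙ ⇒ Dₙ)`, bundled with the orders. -/
noncomputable def levelAux (D : Type u) [CompletePartialOrder D] :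
    ℕ → Σ X : Type u, CompletePartialOrder X
  | 0 => ⟨D, inferInstance⟩
  | n + 1 =>
    letI := (levelAux D n).2
    ⟨ScottMap (levelAux D n).1 (levelAux D n).1, inferInstance⟩

/-- The `n`-th level `Dₙ`. -/
def Level (D : Type u) [CompletePartialOrder D] (n : ℕ) : Type u := (levelAux D n).1

noncomputable instance (D : Type u) [CompletePartialOrder D] (n : ℕ) :
    CompletePartialOrder (Level D n) := (levelAux D n).2

/-- The injection/projection pairs `(iₙ, jₙ)`: `i₀ x = (y ↦ x)`, `j₀ f = f ⊥`,
`iₙ₊₁ f = iₙ ∘ f ∘ jₙ`, `jₙ₊₁ g = jₙ ∘ g ∘ iₙ`. -/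
noncomputable def levelPair (D : Type u) [CompletePartialOrder D] : (n : ℕ) →
    ScottMap (Level D n) (Level D (n + 1)) × ScottMap (Level D (n + 1)) (Level D n)
  | 0 => (constMap (Level D 0), evalBot (Level D 0))
  | n + 1 =>
    (conjMap (X := Level D n) (Y := Level D (n + 1)) (levelPair D n).1 (levelPair D n).2,
      conjMap (X := Level D (n + 1)) (Y := Level D n) (levelPair D n).2 (levelPair D n).1)

/-- The projection `jₙ : Dₙ₊₁ → Dₙ`. -/
noncomputable def levelProj (D : Type u) [CompletePartialOrder D] (n : ℕ) :
    ScottMap (Level D (n + 1)) (Level D n) := (levelPair D n).2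

/-- Scott's `D∞`: the sequences `x` with `xₙ = jₙ (xₙ₊₁)` for all `n`. -/
@[ext]
structure DInfty (D : Type u) [CompletePartialOrder D] where
  coord : (n : ℕ) → Level D n
  coord_eq : ∀ n, coord n = levelProj D n (coord (n + 1))

/-- The componentwise order on `D∞`. -/
instance (D : Type u) [CompletePartialOrder D] : PartialOrder (DInfty D) where
  le x y := ∀ n, x.coord n ≤ y.coord n
  le_refl x n := le_refl (x.coord n)
  le_trans _ _ _ hxy hyz n := (hxy n).trans (hyz n)
  le_antisymm _ _ hxy hyx := DInfty.ext (funext fun n => (hxy n).antisymm (hyx n))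

/-- The metric `∑_{i ≥ 1} 2⁻ⁱ q(f(aᵢ), g(aᵢ))` on a function space; `a` is indexed from `0`. -/
noncomputable def applicativeMetric {X : Type u} {Y : Type v} [PartialOrder X] [PartialOrder Y]
    (a : ℕ → X) (q : Y → Y → ℝ≥0∞) (f g : ScottMap X Y) : ℝ≥0∞ :=
  ∑' i : ℕ, (2⁻¹ : ℝ≥0∞) ^ (i + 1) * q (f (a i)) (g (a i))

/-- The metrics `pₙ` on the levels: `p₀ = p`, and `pₙ₊₁` is the applicative metric given by `pₙ`
and the enumeration `a n` of elements of `Dₙ`. -/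
noncomputable def levelMetric {D : Type u} [CompletePartialOrder D]
    (a : (n : ℕ) → ℕ → Level D n) (p : D → D → ℝ≥0∞) :
    (n : ℕ) → Level D n → Level D n → ℝ≥0∞
  | 0 => p
  | n + 1 => applicativeMetric (X := Level D n) (Y := Level D n) (a n) (levelMetric a p n)

/-- `p∞(x,y) = ∑_{n ≥ 1} 2⁻ⁿ pₙ(xₙ, yₙ)`. -/
noncomputable def metricInfty {D : Type u} [CompletePartialOrder D]
    (a : (n : ℕ) → ℕ → Level D n) (p : D → D → ℝ≥0∞) (x y : DInfty D) : ℝ≥0∞ :=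
  ∑' n : ℕ, (2⁻¹ : ℝ≥0∞) ^ (n + 1) * levelMetric a p (n + 1) (x.coord (n + 1)) (y.coord (n + 1))

end InverseLimit

end ScottModel

/-! Every metric built here is a weighted sum `∑ 2⁻ⁱ⁻¹ qᵢ(eᵢ z, eᵢ w)` along jointly injective Scott
continuous maps `eᵢ`: evaluations at basis points for `Dₙ₊₁`, coordinates for `D∞`.
`quantifies_weightedSum` treats both at once, provided the Scott topology is initial for the `eᵢ`.
Balls are Scott open because the complementary sum `∑ 2⁻ⁱ⁻¹ (1 - qᵢ)` is lower semicontinuous.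
Conversely, a ball of radius `2⁻ⁱ⁻¹ δ` lies in the preimage under `eᵢ` of a `δ`-ball. Initiality on
a function space: `f` is the supremum of the step functions `c ↘ b` with `b ≪ f c`. By bounded
completeness, an open set containing `f` already contains a finite supremum of these, and finitely
many conditions `b ≪ h c` force `h` above it. Initiality on `D∞`: `x` is the supremum of the chain
of images of its coordinates `xₙ`, so a single coordinate suffices. -/

namespace ScottModel

universe u v

/-! ### Scott open sets -/

section ScottOpen

variable {X : Type u} {Y : Type v} [PartialOrder X] [PartialOrder Y]

theorem directedOn_image_of_monotone {f : X → Y} (hf : Monotone f) {d : Set X}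
    (hd : DirectedOn (· ≤ ·) d) : DirectedOn (· ≤ ·) (f '' d) := by
  rintro _ ⟨x, hx, rfl⟩ _ ⟨y, hy, rfl⟩
  obtain ⟨z, hz, h1, h2⟩ := hd x hx y hy
  exact ⟨f z, ⟨z, hz, rfl⟩, hf h1, hf h2⟩

theorem isOpen_scott_iff {U : Set X} :
    IsOpen[Topology.scott X Set.univ] U ↔ IsUpperSet U ∧
      ∀ d : Set X, d.Nonempty → DirectedOn (· ≤ ·) d → ∀ s, IsLUB d s → s ∈ U → ∃ z ∈ d, z ∈ U := by
  let _ := Topology.scott X Set.univ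
  have : Topology.IsScott X Set.univ := ⟨rfl⟩
  rw [Topology.IsScott.isOpen_iff_isUpperSet_and_dirSupInaccOn (D := Set.univ),
    dirSupInaccOn_univ]
  exact and_congr_right fun _ =>
    ⟨fun h d h1 h2 s h3 h4 => h h1 h2 h3 h4, fun h d h1 h2 s h3 h4 => h d h1 h2 s h3 h4⟩

theorem ScottContinuous.isOpen_preimage {f : X → Y} (hf : ScottContinuous f) {V : Set Y}
    (hV : IsOpen[Topology.scott Y Set.univ] V) :
    IsOpen[Topology.scott X Set.univ] (f ⁻¹' V) := by
  rw [isOpen_scott_iff] at hV ⊢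
  refine ⟨fun x y hxy hx => hV.1 (hf.monotone hxy) hx, fun d hd hdd s hs hsV => ?_⟩
  obtain ⟨_, ⟨z, hz, rfl⟩, hzV⟩ := hV.2 _ (hd.image f)
    (directedOn_image_of_monotone hf.monotone hdd) _ (hf hd hdd hs) hsV
  exact ⟨z, hz, hzV⟩

end ScottOpen

/-! ### Balls and a pointwise criterion for quantification -/

section PartialMetric

variable {X : Type u} {p : X → X → ℝ≥0∞}

theorem IsPartialMetric.exists_pball_subset_pball (hp : IsPartialMetric p)
    (hp_le : ∀ x y, p x y ≤ 1) {x y : X} {ε : ℝ≥0∞} (hε : ε < ⊤) (hy : y ∈ pball p x ε) :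
    ∃ δ, 0 < δ ∧ δ < ⊤ ∧ pball p y δ ⊆ pball p x ε := by
  have hfin : ∀ x y, p x y ≠ ⊤ := fun x y => ((hp_le x y).trans_lt ENNReal.one_lt_top).ne
  -- The new radius is the slack left in the strict inequality that puts `y` in the ball.
  refine ⟨p x x + ε - p y x, tsub_pos_of_lt hy,
    tsub_le_self.trans_lt (ENNReal.add_lt_top.2 ⟨(hfin x x).lt_top, hε⟩), fun z hz => ?_⟩
  have h1 := hp.triangle z x y
  have h2 : p z y < p y y + (p x x + ε - p y x) := hz
  have h3 : p z x + p y y < p x x + ε + p y y :=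
    calc p z x + p y y ≤ p z y + p y x := h1
      _ < p y y + (p x x + ε - p y x) + p y x := ENNReal.add_lt_add_right (hfin y x) h2
      _ = p x x + ε + p y y := by
        rw [add_assoc, tsub_add_cancel_of_le (le_of_lt hy), add_comm]
  exact lt_of_add_lt_add_right h3

theorem quantifies_iff [PartialOrder X] (hp : IsPartialMetric p) (hp_le : ∀ x y, p x y ≤ 1) :
    Quantifies p ↔
      (∀ x r, IsOpen[Topology.scott X Set.univ] {y | p y x < r}) ∧
      ∀ U, IsOpen[Topology.scott X Set.univ] U → ∀ x ∈ U,
        ∃ ε, 0 < ε ∧ ε < ⊤ ∧ pball p x ε ⊆ U := by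
  have hfin : ∀ x y, p x y ≠ ⊤ := fun x y => ((hp_le x y).trans_lt ENNReal.one_lt_top).ne
  let _ := Topology.scott X Set.univ
  constructor
  · intro h
    refine ⟨fun x r => ?_, fun U hU x hx => ?_⟩
    -- A genuine ball has positive finite radius; `r ≤ p x x` gives the empty set and `r = ⊤` the
    -- whole space.
    · rcases le_or_gt r (p x x) with hr | hr
      · have : {y | p y x < r} = ∅ := Set.eq_empty_of_forall_notMem fun y hy =>
          (lt_of_lt_of_le hy hr).not_ge ((hp.self_le x y).trans (hp.symm x y).le)
        rw [this]
        exact isOpen_empty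
      · rcases eq_or_ne r ⊤ with rfl | hr'
        · have : {y | p y x < ⊤} = Set.univ := Set.eq_univ_of_forall fun y => (hfin y x).lt_top
          rw [this]
          exact isOpen_univ
        · have : {y | p y x < r} ∈ pOpens p := by
            refine ⟨{(x, r - p x x)}, ?_, ?_⟩
            · rintro _ rfl
              exact ⟨tsub_pos_of_lt hr, tsub_le_self.trans_lt hr'.lt_top⟩
            · simp [pball, add_tsub_cancel_of_le hr.le]
          rw [h] at this
          exact this
    · have hU' : U ∈ pOpens p := by rw [h]; exact hU
      obtain ⟨S, hS, rfl⟩ := hU'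
      obtain ⟨c, hc, hxc⟩ := Set.mem_iUnion₂.1 hx
      obtain ⟨δ, h1, h2, h3⟩ := hp.exists_pball_subset_pball hp_le (hS c hc).2 hxc
      exact ⟨δ, h1, h2, h3.trans (Set.subset_biUnion_of_mem (u := fun c => pball p c.1 c.2) hc)⟩
  · rintro ⟨h1, h2⟩
    refine Set.Subset.antisymm ?_ fun U hU => ?_
    · rintro _ ⟨S, -, rfl⟩
      exact isOpen_biUnion fun c _ => h1 _ _
    · refine ⟨{c | 0 < c.2 ∧ c.2 < ⊤ ∧ pball p c.1 c.2 ⊆ U}, fun c hc => ⟨hc.1, hc.2.1⟩, ?_⟩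
      refine Set.Subset.antisymm (fun x hx => ?_) (Set.iUnion₂_subset fun c hc => hc.2.2)
      obtain ⟨ε, h3, h4, h5⟩ := h2 U hU x hx
      exact Set.mem_iUnion₂.2 ⟨(x, ε), ⟨h3, h4, h5⟩, ENNReal.lt_add_right (hfin x x) h3.ne'⟩

end PartialMetric

/-! ### Weighted sums of partial metrics -/

section WeightedSum

variable {Z : Type u} {Y : ℕ → Type v}

/-- The weighted sum `∑ 2⁻ⁱ⁻¹ qᵢ(eᵢ z, eᵢ w)` of a sequence of distance functions. -/
noncomputable def weightedSum (e : ∀ i, Z → Y i) (q : ∀ i, Y i → Y i → ℝ≥0∞) (z w : Z) : ℝ≥0∞ :=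
  ∑' i : ℕ, (2⁻¹ : ℝ≥0∞) ^ (i + 1) * q i (e i z) (e i w)

theorem tsum_two_inv_pow_succ : ∑' i : ℕ, (2⁻¹ : ℝ≥0∞) ^ (i + 1) = 1 := by
  rw [ENNReal.tsum_geometric_add_one, ENNReal.one_sub_inv_two, inv_inv]
  exact ENNReal.inv_mul_cancel two_ne_zero ENNReal.ofNat_ne_top

theorem two_inv_pow_ne_zero (i : ℕ) : (2⁻¹ : ℝ≥0∞) ^ i ≠ 0 :=
  pow_ne_zero _ (ENNReal.inv_ne_zero.2 ENNReal.ofNat_ne_top)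

theorem two_inv_pow_ne_top (i : ℕ) : (2⁻¹ : ℝ≥0∞) ^ i ≠ ⊤ :=
  ENNReal.pow_ne_top (ENNReal.inv_ne_top.2 two_ne_zero)

variable {e : ∀ i, Z → Y i} {q : ∀ i, Y i → Y i → ℝ≥0∞}

theorem weightedSum_le_one (hq_le : ∀ i x y, q i x y ≤ 1) (z w : Z) : weightedSum e q z w ≤ 1 :=
  (ENNReal.tsum_le_tsum fun i => mul_le_of_le_one_right' (hq_le i _ _)).trans
    tsum_two_inv_pow_succ.le

theorem isPartialMetric_weightedSum (hq : ∀ i, IsPartialMetric (q i))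
    (hq_le : ∀ i x y, q i x y ≤ 1) (he : ∀ z w, (∀ i, e i z = e i w) → z = w) :
    IsPartialMetric (weightedSum e q) where
  self_le x y := ENNReal.tsum_le_tsum fun i => mul_le_mul_right ((hq i).self_le _ _) _
  eq_of_eq x y h1 h2 := by
    -- Terms compare by `self_le` and the sums are finite, so equality of sums forces equality term
    -- by term.
    have key : ∀ x y : Z, weightedSum e q x x = weightedSum e q x y →
        ∀ i, q i (e i x) (e i x) = q i (e i x) (e i y) := by
      intro x y h i
      refine ((hq i).self_le _ _).eq_of_not_lt fun hlt => h.not_lt ?_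
      refine ENNReal.tsum_lt_tsum (i := i)
        ((weightedSum_le_one hq_le x x).trans_lt ENNReal.one_lt_top).ne
        (fun i => mul_le_mul_right ((hq i).self_le _ _) _) ?_
      exact (ENNReal.mul_lt_mul_iff_right (two_inv_pow_ne_zero _) (two_inv_pow_ne_top _)).2 hlt
    refine he x y fun i => (hq i).eq_of_eq _ _ (key x y h1 i) ?_
    rw [(hq i).symm]
    refine (key y x ?_ i).symm
    rw [← h2]
    exact tsum_congr fun i => by rw [(hq i).symm]
  symm x y := tsum_congr fun i => by rw [(hq i).symm]
  triangle x y z := by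
    simp only [weightedSum]
    rw [← ENNReal.tsum_add, ← ENNReal.tsum_add]
    refine ENNReal.tsum_le_tsum fun i => ?_
    rw [← mul_add, ← mul_add]
    exact mul_le_mul_right ((hq i).triangle _ _ _) _

/-- No term can drop below its value at `z`, so an excess `δ` in the `i`-th distance cannot be
compensated elsewhere and costs at least `2⁻ⁱ⁻¹ δ` in the sum. -/
theorem mem_pball_of_mem_pball_weightedSum (hq : ∀ i, IsPartialMetric (q i))
    {z w : Z} {δ : ℝ≥0∞} (i : ℕ)
    (hw : w ∈ pball (weightedSum e q) z ((2⁻¹ : ℝ≥0∞) ^ (i + 1) * δ)) :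
    e i w ∈ pball (q i) (e i z) δ := by
  have hself : ∀ j, q j (e j z) (e j z) ≤ q j (e j w) (e j z) := fun j =>
    ((hq j).self_le _ _).trans ((hq j).symm _ _).le
  by_contra hcon
  have hcon' : q i (e i z) (e i z) + δ ≤ q i (e i w) (e i z) := not_lt.1 hcon
  refine (not_le.2 (show weightedSum e q w z < _ from hw)) ?_
  have h1 : ∑' j, (if j = i then (2⁻¹ : ℝ≥0∞) ^ (i + 1) * δ else 0) =
      (2⁻¹ : ℝ≥0∞) ^ (i + 1) * δ := tsum_ite_eq i _
  rw [← h1]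
  simp only [weightedSum]
  rw [← ENNReal.tsum_add]
  refine ENNReal.tsum_le_tsum fun j => ?_
  split_ifs with hj
  · subst hj
    rw [← mul_add]
    exact mul_le_mul_right hcon' _
  · rw [add_zero]
    exact mul_le_mul_right (hself j) _

variable [PartialOrder Z] [∀ i, PartialOrder (Y i)]

theorem isOpen_setOf_weightedSum_lt (hq : ∀ i, IsPartialMetric (q i))
    (hq_le : ∀ i x y, q i x y ≤ 1) (hqq : ∀ i, Quantifies (q i))
    (he : ∀ i, ScottContinuous (e i)) (z : Z) (r : ℝ≥0∞) :
    IsOpen[Topology.scott Z Set.univ] {w | weightedSum e q w z < r} := by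
  let _ := Topology.scott Z Set.univ
  -- Infinite sums preserve lower, not upper, semicontinuity, hence the passage to `1 - q`; the
  -- weights add up to `1`.
  have hlsc : LowerSemicontinuous fun w =>
      ∑' i, (2⁻¹ : ℝ≥0∞) ^ (i + 1) * (1 - q i (e i w) (e i z)) := by
    refine lowerSemicontinuous_tsum fun i => lowerSemicontinuous_iff_isOpen_preimage.2 fun t => ?_
    have : (fun w => (2⁻¹ : ℝ≥0∞) ^ (i + 1) * (1 - q i (e i w) (e i z))) ⁻¹' Set.Ioi t =
        e i ⁻¹' {y | q i y (e i z) < 1 - t / (2⁻¹ : ℝ≥0∞) ^ (i + 1)} := by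
      ext w
      simp only [Set.mem_preimage, Set.mem_Ioi, Set.mem_ofPred_eq]
      rw [mul_comm, ← ENNReal.div_lt_iff (Or.inl (two_inv_pow_ne_zero _))
        (Or.inl (two_inv_pow_ne_top _)), lt_tsub_iff_right, lt_tsub_iff_left]
    rw [this]
    exact ScottContinuous.isOpen_preimage (he i) (((quantifies_iff (hq i) (hq_le i)).1 (hqq i)).1 _ _)
  have hsum : ∀ w, weightedSum e q w z +
      ∑' i, (2⁻¹ : ℝ≥0∞) ^ (i + 1) * (1 - q i (e i w) (e i z)) = 1 := by
    intro w
    rw [weightedSum, ← ENNReal.tsum_add]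
    refine Eq.trans ?_ tsum_two_inv_pow_succ
    refine tsum_congr fun i => ?_
    rw [← mul_add, add_tsub_cancel_of_le (hq_le _ _ _), mul_one]
  rcases lt_or_ge 1 r with hr | hr
  · have : {w | weightedSum e q w z < r} = Set.univ :=
      Set.eq_univ_of_forall fun w => (weightedSum_le_one hq_le w z).trans_lt hr
    rw [this]
    exact isOpen_univ
  · convert lowerSemicontinuous_iff_isOpen_preimage.1 hlsc (1 - r) using 1
    ext w
    simp only [Set.mem_preimage, Set.mem_Ioi, Set.mem_ofPred_eq]
    have hs := hsum w
    have hfin : weightedSum e q w z ≠ ⊤ :=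
      ((weightedSum_le_one hq_le w z).trans_lt ENNReal.one_lt_top).ne
    have hL := ENNReal.eq_sub_of_add_eq' ENNReal.one_ne_top ((add_comm _ _).trans hs)
    rw [hL, lt_tsub_iff_right]
    nth_rewrite 2 [← tsub_add_cancel_of_le hr]
    exact (ENNReal.add_lt_add_iff_left (tsub_le_self.trans_lt ENNReal.one_lt_top).ne).symm

/-- If the Scott topology of `Z` is the initial topology for the maps `e i` at every point, then
the weighted sum of quantifying partial metrics quantifies `Z`. -/
theorem quantifies_weightedSum (hq : ∀ i, IsPartialMetric (q i))
    (hq_le : ∀ i x y, q i x y ≤ 1) (hqq : ∀ i, Quantifies (q i))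
    (he : ∀ i, ScottContinuous (e i)) (hinj : ∀ z w, (∀ i, e i z = e i w) → z = w)
    (hinit : ∀ U, IsOpen[Topology.scott Z Set.univ] U → ∀ z ∈ U, ∃ S : Set (Set Z), S.Finite ∧
      (∀ W ∈ S, ∃ i V, IsOpen[Topology.scott (Y i) Set.univ] V ∧ e i z ∈ V ∧ e i ⁻¹' V ⊆ W) ∧
      ⋂₀ S ⊆ U) :
    Quantifies (weightedSum e q) := by
  refine (quantifies_iff (isPartialMetric_weightedSum hq hq_le hinj)
    (weightedSum_le_one hq_le)).2
    ⟨isOpen_setOf_weightedSum_lt hq hq_le hqq he, fun U hU z hz => ?_⟩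
  obtain ⟨S, hS, hSV, hSU⟩ := hinit U hU z hz
  suffices h : ∃ ε, 0 < ε ∧ ε < ⊤ ∧ pball (weightedSum e q) z ε ⊆ ⋂₀ S by
    obtain ⟨ε, h1, h2, h3⟩ := h
    exact ⟨ε, h1, h2, h3.trans hSU⟩
  -- The inclusion in `U` does not pass to subfamilies, so it must not enter the induction.
  clear hSU
  induction S, hS using Set.Finite.induction_on with
  | empty => exact ⟨1, one_pos, ENNReal.one_lt_top, by simp⟩
  | @insert W S _ _ ih =>
    obtain ⟨ε, h1, h2, h3⟩ := ih fun W' hW' => hSV W' (Set.mem_insert_of_mem _ hW')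
    obtain ⟨i, V, hV, hzV, hVW⟩ := hSV W (Set.mem_insert _ _)
    obtain ⟨δ, h4, h5, h6⟩ := ((quantifies_iff (hq i) (hq_le i)).1 (hqq i)).2 V hV _ hzV
    refine ⟨min ε ((2⁻¹ : ℝ≥0∞) ^ (i + 1) * δ),
      lt_min h1 (ENNReal.mul_pos (two_inv_pow_ne_zero _) h4.ne'), (min_le_left _ _).trans_lt h2,
      fun w hw => ?_⟩
    have hmono : ∀ {η}, min ε ((2⁻¹ : ℝ≥0∞) ^ (i + 1) * δ) ≤ η →
        w ∈ pball (weightedSum e q) z η := fun hη => lt_of_lt_of_le hw (add_le_add_right hη _)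
    rw [Set.sInter_insert]
    exact ⟨hVW (h6 (mem_pball_of_mem_pball_weightedSum hq i (hmono (min_le_right _ _)))),
      h3 (hmono (min_le_left _ _))⟩

end WeightedSum

/-! ### The way-below relation and interpolation -/

section WayBelow

variable {X : Type u} [PartialOrder X] {x y z : X} {B : Set X}

theorem WayBelow.le (h : WayBelow x y) : x ≤ y := by
  obtain ⟨z, rfl, hz⟩ := h {y} (Set.singleton_nonempty y) (directedOn_singleton y) y
    isLUB_singleton le_rfl
  exact hz

theorem WayBelow.mono_right (h : WayBelow x y) (hyz : y ≤ z) : WayBelow x z :=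
  fun d hd hdd s hs hzs => h d hd hdd s hs (hyz.trans hzs)

theorem WayBelow.mono_left (h : WayBelow y z) (hxy : x ≤ y) : WayBelow x z :=
  fun d hd hdd s hs hzs => (h d hd hdd s hs hzs).imp fun _ hw => ⟨hw.1, hxy.trans hw.2⟩

/-- The basis elements two way-below steps under `y` are directed with supremum `y`, so one of them
dominates `x`. -/
theorem IsDomainBasis.exists_between (hB : IsDomainBasis B) (h : WayBelow x y) :
    ∃ z ∈ B, WayBelow x z ∧ WayBelow z y := by
  let d : Set X := {w | w ∈ B ∧ ∃ z ∈ B, WayBelow w z ∧ WayBelow z y}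
  have hne : d.Nonempty := by
    obtain ⟨z, hz⟩ := (hB y).1
    obtain ⟨w, hw⟩ := (hB z).1
    exact ⟨w, hw.1, z, hz.1, hw.2, hz.2⟩
  have hdir : DirectedOn (· ≤ ·) d := by
    rintro w₁ ⟨-, z₁, hz₁, hwz₁, hzy₁⟩ w₂ ⟨-, z₂, hz₂, hwz₂, hzy₂⟩
    obtain ⟨z, ⟨hz, hzy⟩, h₁, h₂⟩ := (hB y).2.1 z₁ ⟨hz₁, hzy₁⟩ z₂ ⟨hz₂, hzy₂⟩
    obtain ⟨v₁, hv₁, hwv₁⟩ := (hwz₁.mono_right h₁) _ (hB z).1 (hB z).2.1 z (hB z).2.2 le_rfl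
    obtain ⟨v₂, hv₂, hwv₂⟩ := (hwz₂.mono_right h₂) _ (hB z).1 (hB z).2.1 z (hB z).2.2 le_rfl
    obtain ⟨v, hv, h₃, h₄⟩ := (hB z).2.1 v₁ hv₁ v₂ hv₂
    exact ⟨v, ⟨hv.1, z, hz, hv.2, hzy⟩, hwv₁.trans h₃, hwv₂.trans h₄⟩
  have hlub : IsLUB d y := by
    refine ⟨fun w ⟨_, z, _, hwz, hzy⟩ => hwz.le.trans hzy.le, fun b hb => ?_⟩
    refine (hB y).2.2.2 fun z hz => (hB z).2.2.2 fun w hw => hb ⟨hw.1, z, hz.1, hw.2, hz.2⟩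
  obtain ⟨w, ⟨-, z, hz, hwz, hzy⟩, hxw⟩ := h d hne hdir y hlub le_rfl
  exact ⟨z, hz, hwz.mono_left hxw, hzy⟩

theorem IsDomainBasis.isOpen_setOf_wayBelow (hB : IsDomainBasis B) (x : X) :
    IsOpen[Topology.scott X Set.univ] {y | WayBelow x y} := by
  refine isOpen_scott_iff.2 ⟨fun y z hyz hy => hy.mono_right hyz, fun d hd hdd s hs hxs => ?_⟩
  obtain ⟨z, -, hxz, hzs⟩ := hB.exists_between hxs
  obtain ⟨w, hw, hzw⟩ := hzs d hd hdd s hs le_rfl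
  exact ⟨w, hw, hxz.mono_right hzw⟩

end WayBelow

/-! ### Step functions and the Scott topology of a function space -/

section FunctionSpace

variable {X : Type u} {Y : Type v} [PartialOrder X] [CompletePartialOrder Y]

open Classical in
/-- The step function with value `b` at the points that `c` is way below and `⊥` elsewhere. -/
noncomputable def stepMap {B : Set X} (hB : IsDomainBasis B) (c : X) (b : Y) : ScottMap X Y :=
  ⟨fun x => if WayBelow c x then b else ⊥, by
    intro d hd hdd s hs
    constructor
    · rintro _ ⟨x, hx, rfl⟩
      by_cases h : WayBelow c x
      · simp only [if_pos h, if_pos (h.mono_right (hs.1 hx)), le_refl]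
      · simp only [if_neg h, bot_le]
    · intro t ht
      by_cases h : WayBelow c s
      · obtain ⟨x, hx, hcx⟩ := (isOpen_scott_iff.1 (hB.isOpen_setOf_wayBelow c)).2 d hd hdd s hs h
        have := ht ⟨x, hx, rfl⟩
        simp only [if_pos (show WayBelow c x from hcx)] at this
        simpa only [if_pos h] using this
      · simp only [if_neg h, bot_le]⟩

theorem stepMap_apply_of_wayBelow {B : Set X} (hB : IsDomainBasis B) {c x : X} (b : Y)
    (h : WayBelow c x) : stepMap hB c b x = b := if_pos h

open Classical in
theorem stepMap_le {B : Set X} (hB : IsDomainBasis B) {c : X} {b : Y} {f : ScottMap X Y}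
    (h : b ≤ f c) : stepMap hB c b ≤ f := by
  intro x
  show (if WayBelow c x then b else ⊥) ≤ f x
  split_ifs with hx
  · exact h.trans (f.cont.monotone hx.le)
  · exact bot_le

/-- Pointwise suprema stay Scott continuous because suprema commute with suprema. -/
theorem exists_isLUB_scottMap
    (hY : ∀ S : Set Y, S.Finite → BddAbove S → ∃ s, IsLUB S s)
    (F : Set (ScottMap X Y)) (hF : F.Finite) (hFb : BddAbove F) : ∃ s, IsLUB F s := by
  obtain ⟨g, hg⟩ := hFb
  have h : ∀ x, ∃ s, IsLUB ((fun f : ScottMap X Y => f x) '' F) s := fun x =>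
    hY _ (hF.image _) ⟨g x, by rintro _ ⟨f, hf, rfl⟩; exact hg hf x⟩
  choose s hs using h
  have hcont : ScottContinuous s := by
    intro d hd hdd a ha
    constructor
    · rintro _ ⟨x, hx, rfl⟩
      refine (hs x).2 ?_
      rintro _ ⟨f, hf, rfl⟩
      exact (f.cont.monotone (ha.1 hx)).trans ((hs a).1 ⟨f, hf, rfl⟩)
    · intro b hb
      refine (hs a).2 ?_
      rintro _ ⟨f, hf, rfl⟩
      refine (f.cont hd hdd ha).2 ?_
      rintro _ ⟨x, hx, rfl⟩
      exact ((hs x).1 ⟨f, hf, rfl⟩).trans (hb ⟨x, hx, rfl⟩)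
  refine ⟨⟨s, hcont⟩, fun f hf x => (hs x).1 ⟨f, hf, rfl⟩, fun t ht x => (hs x).2 ?_⟩
  rintro _ ⟨f, hf, rfl⟩
  exact ht hf x

/-- `K` need not be directed, but the suprema of its finite subsets are, and they have the same
supremum `z`; the empty subset makes this family nonempty. -/
theorem exists_finite_subset_isLUB_mem {Z : Type u} [PartialOrder Z]
    (hZ : ∀ S : Set Z, S.Finite → BddAbove S → ∃ s, IsLUB S s) {K : Set Z} {z : Z}
    (hK : IsLUB K z) {U : Set Z} (hU : IsOpen[Topology.scott Z Set.univ] U) (hz : z ∈ U) :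
    ∃ F ⊆ K, F.Finite ∧ ∃ s ∈ U, IsLUB F s := by
  have hlub : ∀ F ⊆ K, F.Finite → ∃ s, IsLUB F s := fun F hF hfin =>
    hZ F hfin ⟨z, fun k hk => hK.1 (hF hk)⟩
  obtain ⟨s, ⟨F, hF, hfin, hs⟩, hsU⟩ :=
    (isOpen_scott_iff.1 hU).2 {s | ∃ F ⊆ K, F.Finite ∧ IsLUB F s} (by
      obtain ⟨s, hs⟩ := hlub ∅ (Set.empty_subset _) Set.finite_empty
      exact ⟨s, ∅, Set.empty_subset _, Set.finite_empty, hs⟩) (by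
      rintro s₁ ⟨F₁, hF₁, hfin₁, hs₁⟩ s₂ ⟨F₂, hF₂, hfin₂, hs₂⟩
      obtain ⟨s, hs⟩ := hlub (F₁ ∪ F₂) (Set.union_subset hF₁ hF₂) (hfin₁.union hfin₂)
      exact ⟨s, ⟨F₁ ∪ F₂, Set.union_subset hF₁ hF₂, hfin₁.union hfin₂, hs⟩,
        hs₁.mono hs Set.subset_union_left, hs₂.mono hs Set.subset_union_right⟩) z
      ⟨by
        rintro s ⟨F, hF, -, hs⟩
        exact hs.2 fun k hk => hK.1 (hF hk), fun b hb => hK.2 fun k hk =>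
          hb ⟨{k}, Set.singleton_subset_iff.2 hk, Set.finite_singleton k, isLUB_singleton⟩⟩ hz
  exact ⟨F, hF, hfin, s, hsU, hs⟩

/-- By continuity `f x` is the supremum of `f c` over basis elements `c ≪ x`, and each `f c` is the
supremum of the basis elements way below it. -/
theorem isLUB_setOf_stepMap {A : Set X} (hA : IsDomainBasis A) {B : Set Y} (hB : IsDomainBasis B)
    (f : ScottMap X Y) :
    IsLUB {g | ∃ c ∈ A, ∃ b, WayBelow b (f c) ∧ stepMap hA c b = g} f := by
  constructor
  · rintro _ ⟨c, -, b, hb, rfl⟩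
    exact stepMap_le hA hb.le
  · intro h hh x
    refine (f.cont (hA x).1 (hA x).2.1 (hA x).2.2).2 ?_
    rintro _ ⟨c, ⟨hc, hcx⟩, rfl⟩
    refine (hB (f c)).2.2.2 fun b hb => ?_
    have := hh ⟨c, hc, b, hb.2, rfl⟩ x
    rwa [stepMap_apply_of_wayBelow hA b hcx] at this

theorem ScottMap.ext_of_basis {A : Set X} (hA : IsDomainBasis A) {f g : ScottMap X Y}
    (h : ∀ c ∈ A, f c = g c) : f = g := by
  refine ScottMap.ext (funext fun x => ?_)
  refine (f.cont (hA x).1 (hA x).2.1 (hA x).2.2).unique ?_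
  convert g.cont (hA x).1 (hA x).2.1 (hA x).2.2 using 1
  exact Set.image_congr fun c hc => h c hc.1

theorem scottContinuous_eval (x : X) : ScottContinuous fun f : ScottMap X Y => f x :=
  fun _ _ hF _ hg => isLUB_eval hF hg x

theorem isPartialMetric_applicativeMetric {a : ℕ → X} (ha : IsDomainBasis (Set.range a))
    {q : Y → Y → ℝ≥0∞} (hq : IsPartialMetric q) (hq_le : ∀ x y, q x y ≤ 1) :
    IsPartialMetric (applicativeMetric a q) :=
  isPartialMetric_weightedSum (e := fun i (f : ScottMap X Y) => f (a i)) (fun _ => hq)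
    (fun _ => hq_le) fun _ _ h => ScottMap.ext_of_basis ha (Set.forall_mem_range.2 h)

theorem quantifies_applicativeMetric {a : ℕ → X} (ha : IsDomainBasis (Set.range a))
    {B : Set Y} (hB : IsDomainBasis B)
    (hY : ∀ S : Set Y, S.Finite → BddAbove S → ∃ s, IsLUB S s)
    {q : Y → Y → ℝ≥0∞} (hq : IsPartialMetric q) (hq_le : ∀ x y, q x y ≤ 1)
    (hqq : Quantifies q) : Quantifies (applicativeMetric a q) := by
  refine quantifies_weightedSum (e := fun i (f : ScottMap X Y) => f (a i)) (fun _ => hq)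
    (fun _ => hq_le) (fun _ => hqq) (fun i => scottContinuous_eval (a i))
    (fun _ _ h => ScottMap.ext_of_basis ha (Set.forall_mem_range.2 h)) fun U hU f hf => ?_
  obtain ⟨F, hFK, hFfin, s, hsU, hs⟩ := exists_finite_subset_isLUB_mem
    (exists_isLUB_scottMap hY) (isLUB_setOf_stepMap ha hB f) hU hf
  refine ⟨(fun g => {h : ScottMap X Y | g ≤ h}) '' F, hFfin.image _, ?_, fun h hh => ?_⟩
  · rintro _ ⟨g, hg, rfl⟩
    obtain ⟨_, ⟨i, rfl⟩, b, hb, rfl⟩ := hFK hg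
    exact ⟨i, {y | WayBelow b y}, hB.isOpen_setOf_wayBelow b, hb,
      fun h hh => stepMap_le ha (WayBelow.le hh)⟩
  · exact (isOpen_scott_iff.1 hU).1 (hs.2 fun g hg => hh _ ⟨g, hg, rfl⟩) hsU

end FunctionSpace

/-! ### The levels `Dₙ` and their embedding-projection pairs -/

section Levels

variable {D : Type u} [CompletePartialOrder D]

/-- The embedding `iₙ : Dₙ → Dₙ₊₁`. -/
noncomputable def levelEmb (D : Type u) [CompletePartialOrder D] (n : ℕ) :
    ScottMap (Level D n) (Level D (n + 1)) := (levelPair D n).1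

theorem levelProj_levelEmb (n : ℕ) (x : Level D n) : levelProj D n (levelEmb D n x) = x := by
  induction n with
  | zero => rfl
  | succ n ih =>
    refine ScottMap.ext (X := Level D n) (Y := Level D n) (funext fun y => ?_)
    let f : ScottMap (Level D n) (Level D n) := x
    change levelProj D n (levelEmb D n (f (levelProj D n (levelEmb D n y)))) = f y
    rw [ih, ih]

theorem levelEmb_levelProj_le (n : ℕ) (x : Level D (n + 1)) :
    levelEmb D n (levelProj D n x) ≤ x := by
  induction n with
  | zero =>
    intro y
    let f : ScottMap (Level D 0) (Level D 0) := x
    exact f.cont.monotone (show (⊥ : Level D 0) ≤ y from bot_le)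
  | succ n ih =>
    intro y
    let f : ScottMap (Level D (n + 1)) (Level D (n + 1)) := x
    change levelEmb D n (levelProj D n (f (levelEmb D n (levelProj D n y)))) ≤ f y
    exact (ih _).trans (f.cont.monotone (ih y))

/-- Only finite suprema need to be carried up the levels, since a basis of each level is given. -/
theorem exists_isLUB_level
    (hD : ∀ S : Set D, S.Finite → BddAbove S → ∃ s, IsLUB S s) (n : ℕ) :
    ∀ S : Set (Level D n), S.Finite → BddAbove S → ∃ s, IsLUB S s := by
  induction n with
  | zero => exact hD
  | succ n ih => exact exists_isLUB_scottMap (X := Level D n) (Y := Level D n) ih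

theorem levelMetric_le_one {p : D → D → ℝ≥0∞} (hp_le : ∀ x y, p x y ≤ 1)
    (a : (n : ℕ) → ℕ → Level D n) (n : ℕ) (x y : Level D n) : levelMetric a p n x y ≤ 1 := by
  induction n with
  | zero => exact hp_le x y
  | succ n ih =>
    exact weightedSum_le_one (Z := ScottMap (Level D n) (Level D n)) (Y := fun _ => Level D n)
      (e := fun i f => f (a n i)) (q := fun _ => levelMetric a p n) (fun _ => ih) x y

theorem isPartialMetric_levelMetric {p : D → D → ℝ≥0∞} (hp : IsPartialMetric p)
    (hp_le : ∀ x y, p x y ≤ 1) {a : (n : ℕ) → ℕ → Level D n}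
    (ha : ∀ n, IsDomainBasis (Set.range (a n))) (n : ℕ) :
    IsPartialMetric (levelMetric a p n) := by
  induction n with
  | zero => exact hp
  | succ n ih =>
    exact isPartialMetric_applicativeMetric (X := Level D n) (Y := Level D n) (ha n) ih
      (levelMetric_le_one hp_le a n)

theorem quantifies_levelMetric (hD : ∀ S : Set D, S.Finite → BddAbove S → ∃ s, IsLUB S s)
    {p : D → D → ℝ≥0∞} (hp : IsPartialMetric p) (hp_le : ∀ x y, p x y ≤ 1)
    (hpq : Quantifies p) {a : (n : ℕ) → ℕ → Level D n}
    (ha : ∀ n, IsDomainBasis (Set.range (a n))) (n : ℕ) : Quantifies (levelMetric a p n) := by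
  induction n with
  | zero => exact hpq
  | succ n ih =>
    exact quantifies_applicativeMetric (X := Level D n) (Y := Level D n) (ha n) (ha n)
      (exists_isLUB_level hD n) (isPartialMetric_levelMetric hp hp_le ha n)
      (levelMetric_le_one hp_le a n) ih

end Levels

/-! ### `D∞` as the limit of its levels -/

section InverseLimit

variable {D : Type u} [CompletePartialOrder D]

/-- The iterated embedding `Dₙ → Dₘ` for `n ≤ m`. -/
noncomputable def levelUp {n m : ℕ} (h : n ≤ m) : ScottMap (Level D n) (Level D m) :=
  Nat.leRec (motive := fun m _ => ScottMap (Level D n) (Level D m))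
    ⟨id, ScottContinuous.id⟩ (fun k _ f => (levelEmb D k).comp f) h

/-- The iterated projection `Dₙ → Dₘ` for `m ≤ n`. -/
noncomputable def levelDown {m n : ℕ} (h : m ≤ n) : ScottMap (Level D n) (Level D m) :=
  Nat.leRec (motive := fun n _ => ScottMap (Level D n) (Level D m))
    ⟨id, ScottContinuous.id⟩ (fun k _ f => f.comp (levelProj D k)) h

theorem levelUp_self (n : ℕ) (x : Level D n) : levelUp (le_refl n) x = x := by
  simp only [levelUp, Nat.leRec_self, id]

theorem levelUp_succ {n m : ℕ} (h : n ≤ m) (x : Level D n) :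
    levelUp (h.trans m.le_succ) x = levelEmb D m (levelUp h x) := by
  simp only [levelUp]
  rw [Nat.leRec_succ _ _ h]
  rfl

theorem levelDown_self (n : ℕ) (x : Level D n) : levelDown (le_refl n) x = x := by
  simp only [levelDown, Nat.leRec_self, id]

theorem levelDown_succ {m n : ℕ} (h : m ≤ n) (x : Level D (n + 1)) :
    levelDown (h.trans n.le_succ) x = levelDown h (levelProj D n x) := by
  simp only [levelDown]
  rw [Nat.leRec_succ _ _ h]
  rfl

theorem levelProj_levelDown {m n : ℕ} (h : m + 1 ≤ n) (x : Level D n) :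
    levelProj D m (levelDown h x) = levelDown (m.le_succ.trans h) x := by
  induction n, h using Nat.le_induction with
  | base => rw [levelDown_self, levelDown_succ le_rfl, levelDown_self]
  | succ n h ih => rw [levelDown_succ h, ih, levelDown_succ (m.le_succ.trans h)]

theorem levelDown_coord {m n : ℕ} (h : m ≤ n) (x : DInfty D) :
    levelDown h (x.coord n) = x.coord m := by
  induction n, h using Nat.le_induction with
  | base => exact levelDown_self _ _
  | succ n h ih => rw [levelDown_succ h, ← x.coord_eq, ih]

theorem levelUp_coord_le {n m : ℕ} (h : n ≤ m) (x : DInfty D) :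
    levelUp h (x.coord n) ≤ x.coord m := by
  induction m, h using Nat.le_induction with
  | base => exact (levelUp_self _ _).le
  | succ m h ih =>
    rw [levelUp_succ h]
    refine ((levelEmb D m).cont.monotone ih).trans ?_
    rw [x.coord_eq m]
    exact levelEmb_levelProj_le m _

theorem levelUp_coord_le_levelUp_coord_succ {n m : ℕ} (h : n + 1 ≤ m) (x : DInfty D) :
    levelUp (n.le_succ.trans h) (x.coord n) ≤ levelUp h (x.coord (n + 1)) := by
  induction m, h using Nat.le_induction with
  | base =>
    rw [levelUp_self, levelUp_succ le_rfl, levelUp_self, x.coord_eq n]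
    exact levelEmb_levelProj_le n _
  | succ m h ih =>
    rw [levelUp_succ h, levelUp_succ (n.le_succ.trans h)]
    exact (levelEmb D m).cont.monotone ih

/-- The embedding `Dₙ → D∞`. -/
noncomputable def toInfty (n : ℕ) (x : Level D n) : DInfty D where
  coord m := if h : n ≤ m then levelUp h x else levelDown (le_of_not_ge h) x
  coord_eq m := by
    by_cases h : n ≤ m
    · rw [dif_pos h, dif_pos (h.trans m.le_succ), levelUp_succ h, levelProj_levelEmb]
    · rw [dif_neg h]
      by_cases h' : n ≤ m + 1
      · obtain rfl : n = m + 1 := by omega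
        rw [dif_pos h', levelUp_self, levelDown_succ le_rfl, levelDown_self]
      · rw [dif_neg h', levelProj_levelDown]

theorem toInfty_coord_of_le {n m : ℕ} (h : n ≤ m) (x : Level D n) :
    (toInfty n x).coord m = levelUp h x := dif_pos h

theorem toInfty_coord_of_ge {n m : ℕ} (h : m ≤ n) (x : Level D n) :
    (toInfty n x).coord m = levelDown h x := by
  rcases h.eq_or_lt with rfl | h'
  · rw [toInfty_coord_of_le le_rfl, levelUp_self, levelDown_self]
  · exact dif_neg h'.not_ge

theorem DInfty.isLUB_of_coord {d : Set (DInfty D)} {s : DInfty D}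
    (h : ∀ n, IsLUB ((fun x : DInfty D => x.coord n) '' d) (s.coord n)) : IsLUB d s := by
  refine ⟨fun x hx n => (h n).1 ⟨x, hx, rfl⟩, fun t ht n => (h n).2 ?_⟩
  rintro _ ⟨x, hx, rfl⟩
  exact ht hx n

theorem scottContinuous_coord (n : ℕ) : ScottContinuous fun x : DInfty D => x.coord n := by
  intro d hd hdd s hs
  have hmono : ∀ n, Monotone fun x : DInfty D => x.coord n := fun n x y hxy => hxy n
  have hdir : ∀ n, DirectedOn (· ≤ ·) ((fun x : DInfty D => x.coord n) '' d) := fun n =>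
    directedOn_image_of_monotone (hmono n) hdd
  -- The componentwise supremum is a compatible sequence because each projection is Scott
  -- continuous.
  let t : DInfty D :=
    { coord := fun n => sSup ((fun x : DInfty D => x.coord n) '' d)
      coord_eq := fun n => by
        refine (hdir n).isLUB_sSup.unique ?_
        convert (levelProj D n).cont (hd.image _) (hdir (n + 1)) (hdir (n + 1)).isLUB_sSup using 1
        rw [Set.image_image]
        exact Set.image_congr fun x _ => x.coord_eq n }
  have ht : ∀ n, IsLUB ((fun x : DInfty D => x.coord n) '' d) (t.coord n) := fun n =>
    (hdir n).isLUB_sSup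
  rw [hs.unique (DInfty.isLUB_of_coord ht)]
  exact ht n

theorem scottContinuous_toInfty (n : ℕ) : ScottContinuous (toInfty (D := D) n) := by
  intro d hd hdd s hs
  refine DInfty.isLUB_of_coord fun m => ?_
  rw [Set.image_image]
  rcases le_total n m with h | h
  · simp only [toInfty_coord_of_le h]
    exact (levelUp h).cont hd hdd hs
  · simp only [toInfty_coord_of_ge h]
    exact (levelDown h).cont hd hdd hs

theorem toInfty_coord_le (n : ℕ) (x : DInfty D) : toInfty n (x.coord n) ≤ x := by
  intro m
  rcases le_total n m with h | h
  · rw [toInfty_coord_of_le h]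
    exact levelUp_coord_le h x
  · rw [toInfty_coord_of_ge h, levelDown_coord]

/-- Above level `n` this is `iₙ ∘ jₙ ≤ id` pushed upwards; up to level `n` both sequences agree with
`x`. -/
theorem monotone_toInfty_coord (x : DInfty D) : Monotone fun n => toInfty n (x.coord n) := by
  refine monotone_nat_of_le_succ fun n m => ?_
  rcases le_or_gt (n + 1) m with h | h
  · rw [toInfty_coord_of_le h, toInfty_coord_of_le (n.le_succ.trans h)]
    exact levelUp_coord_le_levelUp_coord_succ h x
  · rw [toInfty_coord_of_ge h.le, toInfty_coord_of_ge (Nat.lt_succ_iff.1 h), levelDown_coord,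
      levelDown_coord]

theorem isLUB_range_toInfty_coord (x : DInfty D) :
    IsLUB (Set.range fun n => toInfty n (x.coord n)) x := by
  refine ⟨Set.forall_mem_range.2 fun n => toInfty_coord_le n x, fun y hy n => ?_⟩
  have := hy ⟨n, rfl⟩ n
  rwa [toInfty_coord_of_ge le_rfl, levelDown_self] at this

/-- The sum defining `p∞` omits coordinate `0`, which is recovered by projection from coordinate
`1`. -/
theorem DInfty.ext_of_coord_succ {x y : DInfty D} (h : ∀ n, x.coord (n + 1) = y.coord (n + 1)) :
    x = y :=
  DInfty.ext (funext fun n => by rw [x.coord_eq, y.coord_eq, h])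

end InverseLimit

end ScottModel

/-! ### Quantification of `D∞` -/

open ScottModel in
theorem mainTheorem2 {D : Type*} [CompletePartialOrder D]
    (hD : ScottModel.IsBoundedCompleteDomain D)
    (p : D → D → ℝ≥0∞) (hp : ScottModel.IsPartialMetric p) (hp_le : ∀ x y, p x y ≤ 1)
    (hpq : ScottModel.Quantifies p)
    (a : (n : ℕ) → ℕ → ScottModel.Level D n)
    (ha : ∀ n, ScottModel.IsDomainBasis (Set.range (a n))) :
    ScottModel.IsPartialMetric (ScottModel.metricInfty a p) ∧
      ScottModel.Quantifies (ScottModel.metricInfty a p) := by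
  have hq := fun n => isPartialMetric_levelMetric hp hp_le ha (n + 1)
  have hq_le := fun n => levelMetric_le_one hp_le a (n + 1)
  refine ⟨isPartialMetric_weightedSum (e := fun n (x : DInfty D) => x.coord (n + 1)) hq hq_le
    fun _ _ => DInfty.ext_of_coord_succ,
    quantifies_weightedSum (e := fun n (x : DInfty D) => x.coord (n + 1)) hq hq_le
      (fun n => quantifies_levelMetric hD.exists_isLUB hp hp_le hpq ha (n + 1))
      (fun n => scottContinuous_coord (n + 1)) (fun _ _ => DInfty.ext_of_coord_succ)
      fun U hU x hx => ?_⟩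
  have hU' := isOpen_scott_iff.1 hU
  obtain ⟨_, ⟨n, rfl⟩, hn⟩ := hU'.2 _ (Set.range_nonempty _)
    (directedOn_range.2 (monotone_toInfty_coord x).directed_le) x
    (isLUB_range_toInfty_coord x) hx
  refine ⟨{U}, Set.finite_singleton U, ?_, (Set.sInter_singleton U).subset⟩
  rintro W (rfl : W = U)
  -- Index `n` of the sum reads coordinate `n + 1`, so the approximant in `U` is first moved one
  -- step up the chain. Any `w` whose approximant lies in `U` is itself in `U`, being above it.
  exact ⟨n, toInfty (n + 1) ⁻¹' W, ScottContinuous.isOpen_preimage (scottContinuous_toInfty _) hU,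
    hU'.1 (monotone_toInfty_coord x n.le_succ) hn,
    fun w hw => hU'.1 (toInfty_coord_le (n + 1) w) hw⟩
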